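/- Let $K$ be a field, let $G$ be a finite simple graph on the vertex set $V=\{v_1,\dots,v_n\}$, let $S=K[X_1,\dots,X_n]$ with its standard grading, and let $I(G)=\langle X_iX_j : v_i \text{ adjacent to } v_j\rangle\subset S$ be the edge ideal of $G$. Call a graded $K$-algebra $R$ universally Koszul if, for every ideal $J$ of $R$ generated by elements of degree $1$, the minimal graded $R$-free resolution of $R/J$ is linear, that is, all matrices representing its maps have entries of degree $1$ (zero entries being allowed). If the edge ring $S/I(G)$ is universally Koszul, then $S/I(G)$ has a linear ($2$-linear) minimal graded free resolution as an $S$-module, that is, one of the form $$\cdots\to S(-4)^{\beta_3}\to S(-3)^{\beta_2}\to S(-2)^{\beta_1}\to S\to S/I(G)\to 0,$$ so that the matrix of the first map has entries of degree $2$ and the matrices of all later maps have entries of degree $1$. -/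

import Mathlib

/-- The grading induced on the quotient `R ⧸ I` by a grading `𝒜` of `R`: the component of degree `i`
is the image of `𝒜 i`. -/
def quotientGrading {K R : Type*} [Field K] [CommRing R] [Algebra K R]
    (𝒜 : ℕ → Submodule K R) (I : Ideal R) : ℕ → Submodule K (R ⧸ I) :=
  fun i => (𝒜 i).map (Ideal.Quotient.mkₐ K I).toLinearMap

/-- The ideal generated by the homogeneous elements of positive degree. -/
def positiveDegreeIdeal {K R : Type*} [Field K] [CommRing R] [Algebra K R]
    (𝒜 : ℕ → Submodule K R) : Ideal R :=
  Ideal.span {a | ∃ e : ℕ, 0 < e ∧ a ∈ 𝒜 e}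

/-- A minimal graded free resolution
`⋯ → F 2 → F 1 → F 0 → M → 0` of a graded module `M` (with components `ℳ`) over a graded `K`-algebra
`R` (with components `𝒜`), where `F i = ⨁ j, R(-deg i j)` has finite rank `rank i`,
and the differential `F (i + 1) → F i` is given by the matrix `d i`. -/
structure MinimalGradedFreeResolution {K R M : Type*} [Field K] [CommRing R] [Algebra K R]
    [AddCommGroup M] [Module R M] [Module K M]
    (𝒜 : ℕ → Submodule K R) (ℳ : ℕ → Submodule K M) where
  /-- the rank of the free module `F i` -/
  rank : ℕ → ℕ
  /-- the degree of the `j`-th basis element of `F i` -/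
  deg : ∀ i : ℕ, Fin (rank i) → ℕ
  /-- the matrix of the differential `F (i + 1) → F i` -/
  d : ∀ i : ℕ, Matrix (Fin (rank i)) (Fin (rank (i + 1))) R
  /-- the augmentation `F 0 → M` -/
  aug : (Fin (rank 0) → R) →ₗ[R] M
  /-- the augmentation preserves degrees -/
  aug_homogeneous : ∀ j, aug (Pi.single j 1) ∈ ℳ (deg 0 j)
  /-- the differentials preserve degrees -/
  d_homogeneous : ∀ i j k,
    d i j k = 0 ∨ ∃ e : ℕ, deg i j + e = deg (i + 1) k ∧ d i j k ∈ 𝒜 e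
  /-- minimality: all matrix entries lie in the ideal of elements of positive degree -/
  minimal : ∀ i j k, d i j k ∈ positiveDegreeIdeal 𝒜
  aug_surjective : Function.Surjective aug
  exact_zero : Function.Exact (d 0).mulVecLin aug
  exact_succ : ∀ i, Function.Exact (d (i + 1)).mulVecLin (d i).mulVecLin

/-- A graded module has a linear (minimal graded free) resolution if all entries of all the matrices
of its minimal graded free resolution are of degree `1` (zero entries being allowed). -/
def HasLinearResolution {K R M : Type*} [Field K] [CommRing R] [Algebra K R]
    [AddCommGroup M] [Module R M] [Module K M]
    (𝒜 : ℕ → Submodule K R) (ℳ : ℕ → Submodule K M) : Prop :=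
  ∃ F : MinimalGradedFreeResolution 𝒜 ℳ, ∀ i j k, F.d i j k ∈ 𝒜 1

/-- The cyclic graded module `R ⧸ I` has a `q`-linear (minimal graded free) resolution
`⋯ → R(-q-2)^β₃ → R(-q-1)^β₂ → R(-q)^β₁ → R → R ⧸ I → 0`: the free module in homological degree `0`
is `R`, and the one in homological degree `i + 1` is generated in degree `q + i`; so the entries of
the first matrix have degree `q`, and those of all later matrices have degree `1`. -/
def HasLinearResolutionOfQuotient {K R : Type*} [Field K] [CommRing R] [Algebra K R]
    (𝒜 : ℕ → Submodule K R) (I : Ideal R) (q : ℕ) : Prop :=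
  ∃ F : MinimalGradedFreeResolution 𝒜 (quotientGrading 𝒜 I),
    F.rank 0 = 1 ∧ (∀ j, F.deg 0 j = 0) ∧ (∀ i j, F.deg (i + 1) j = q + i) ∧
      (∀ j k, F.d 0 j k ∈ 𝒜 q) ∧ (∀ i j k, F.d (i + 1) j k ∈ 𝒜 1)

/-- A graded `K`-algebra `R` is universally Koszul if `R ⧸ J` has a linear `R`-free resolution for
every ideal `J` of `R` that is generated by elements of degree `1`. -/
def IsUniversallyKoszul {K R : Type*} [Field K] [CommRing R] [Algebra K R]
    (𝒜 : ℕ → Submodule K R) : Prop :=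
  ∀ s : Set R, s ⊆ (𝒜 1 : Set R) →
    HasLinearResolution 𝒜 (quotientGrading 𝒜 (Ideal.span s))

/-- The edge ideal of a graph `G` over `K`, generated by the monomials `X v * X w` with `v`, `w`
adjacent in `G`. -/
noncomputable def edgeIdeal (K : Type*) [Field K] {V : Type*} (G : SimpleGraph V) : Ideal (MvPolynomial V K) :=
  Ideal.span {f | ∃ v w : V, G.Adj v w ∧ f = MvPolynomial.X v * MvPolynomial.X w}

/-!
The proof goes through the combinatorics of `G`.

*From the edge ring to the graph.* If `R ⧸ (ℓ)` has a linear resolution over `R = S ⧸ I(G)`, then the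
annihilator of the linear form `ℓ` in `R` is, locally at the origin, generated by linear forms
(`exists_mul_mem_span_linear_annihilators`). Suppose that `{p, q}` and `{r, s}` are edges, while
`{q, r}`, `{p, s}` and `{q, s}` are not. Then `X q * X s` is a nonzero element of `R` annihilating
`X p + X r`, but no linear form annihilating `X p + X r` involves `X q` or `X s`, a contradiction
(`adj_of_isUniversallyKoszul`). So the complement of `G` contains neither an induced path on four
vertices nor an induced four-cycle. Only principal ideals are needed here.

*From the graph to the resolution.* The excluded pattern forces nonadjacent vertices to have nested
neighbourhoods (`SimpleGraph.exists_injective_nested_neighbors`). Order the vertices by decreasing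
degree and the edges lexicographically. Then the ideal of all edges before an edge `{i, j}`, `i < j`,
has colon ideal with respect to `X i * X j` generated by the variables `X k` with `k < i`, together
with those `X k` with `k < j` for which `k` is adjacent to `i` (`colon_initialEdgeIdeal`): edge
ideals of such graphs have linear quotients.

*Linear quotients.* If `I` has a `q`-linear resolution, `m` is of degree `q` and `I : m` has a
`1`-linear resolution, then the mapping cone of multiplication by `m` is a `q`-linear resolution of
`I + (m)` (`LinearMatrixResolution.nonempty_sup_span_singleton`). The same statement, with `q = 1`,
also yields the Koszul resolutions of the ideals generated by variables.
-/

/-! ### Linear resolutions of ideals by matrices -/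

/-- The degree of the entries of the `n`-th matrix in the `q`-linear resolution of `R ⧸ I`: the
first matrix lists the generators of `I`, of degree `q`, and all others have linear entries. -/
def linearEntryDegree (q : ℕ) : ℕ → ℕ
  | 0 => q
  | _ + 1 => 1

/-- A `q`-linear resolution of `R ⧸ I`, given by its matrices `d n : R^(ι (n + 1)) → R^(ι n)`
alone. The bases `ι n` are arbitrary finite types, so that block matrices need no reindexing, and
`ι 0` is a singleton, so that `d 0` is a row, whose entries generate `I`. -/
structure LinearMatrixResolution {K R : Type*} [Field K] [CommRing R] [Algebra K R]
    (𝒜 : ℕ → Submodule K R) (q : ℕ) (I : Ideal R) where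
  /-- the basis of the `n`-th free module -/
  ι : ℕ → Type
  fintype : ∀ n, Fintype (ι n)
  unique : Unique (ι 0)
  /-- the `n`-th matrix -/
  d : ∀ n, Matrix (ι n) (ι (n + 1)) R
  entry_mem : ∀ n i j, d n i j ∈ 𝒜 (linearEntryDegree q n)
  range_zero : ∀ x : ι 0 → R, (∃ y, (d 0).mulVec y = x) ↔ ∀ i, x i ∈ I
  exact : ∀ n x, (d n).mulVec x = 0 ↔ ∃ y, (d (n + 1)).mulVec y = x

attribute [instance] LinearMatrixResolution.fintype

namespace LinearMatrixResolution

variable {K R : Type*} [Field K] [CommRing R] [Algebra K R] {𝒜 : ℕ → Submodule K R}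

lemma d_mul_d {q : ℕ} {I : Ideal R} (F : LinearMatrixResolution 𝒜 q I) (n : ℕ) :
    F.d n * F.d (n + 1) = 0 := by
  classical
  apply Matrix.ext_of_mulVec_single
  intro j
  rw [← Matrix.mulVec_mulVec, (F.exact n _).2 ⟨_, rfl⟩, Matrix.zero_mulVec]

/-- The zero ideal has a `q`-linear resolution for every `q`. -/
theorem nonempty_bot (𝒜 : ℕ → Submodule K R) (q : ℕ) :
    Nonempty (LinearMatrixResolution 𝒜 q (⊥ : Ideal R)) :=
  ⟨{ ι := fun n => match n with
      | 0 => Unit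
      | _ + 1 => Empty
     fintype := fun n => match n with
      | 0 => inferInstanceAs (Fintype Unit)
      | _ + 1 => inferInstanceAs (Fintype Empty)
     unique := inferInstanceAs (Unique Unit)
     d := fun _ _ j => Empty.elim j
     entry_mem := fun _ _ j => Empty.elim j
     range_zero := fun x => by
      constructor
      · rintro ⟨y, rfl⟩ i
        simp [Matrix.mulVec, dotProduct]
      · intro h
        exact ⟨fun j => Empty.elim j, funext fun i => by
          simpa [Matrix.mulVec, dotProduct] using (h i).symm⟩
     exact := fun n x => by
      constructor
      · intro _
        exact ⟨fun j => Empty.elim j, funext fun i => Empty.elim i⟩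
      · intro _
        funext i
        simp [Matrix.mulVec, dotProduct] }⟩

/-! ### Lifting multiplication by an element to a chain map -/

/-- A solution of a homogeneous linear system with homogeneous right-hand side may be chosen
homogeneous: replace it by one of its graded components. -/
lemma exists_homogeneous_solution [GradedAlgebra 𝒜] {α β : Type*} [Fintype β]
    (A : Matrix α β R) {a e : ℕ} (hA : ∀ i j, A i j ∈ 𝒜 a) {x : α → R}
    (hx : ∀ i, x i ∈ 𝒜 (a + e)) (h : ∃ y, A.mulVec y = x) :
    ∃ y, A.mulVec y = x ∧ ∀ j, y j ∈ 𝒜 e := by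
  obtain ⟨y, rfl⟩ := h
  refine ⟨fun j => (DirectSum.decompose 𝒜 (y j) e : R), ?_, fun j => SetLike.coe_mem _⟩
  funext i
  rw [← DirectSum.decompose_of_mem_same 𝒜 (hx i)]
  simp only [Matrix.mulVec, dotProduct, ← GradedRing.proj_apply, map_sum]
  refine Finset.sum_congr rfl fun j _ => ?_
  rw [GradedRing.proj_apply, GradedRing.proj_apply,
    DirectSum.coe_decompose_mul_add_of_left_mem 𝒜 (hA i j)]

/-- The inductive step in the construction of a chain map: the matrix `θ` in position `n` is continued
by a matrix `θ'` in position `n + 1`. -/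
lemma exists_lift_step [GradedAlgebra 𝒜] {q : ℕ} {I J : Ideal R}
    (F : LinearMatrixResolution 𝒜 q I) (L : LinearMatrixResolution 𝒜 1 J) (n : ℕ)
    (θ : Matrix (F.ι n) (L.ι n) R) (hθ : ∀ i j, θ i j ∈ 𝒜 (linearEntryDegree q n))
    (hrange : ∀ y, ∃ z, (F.d n).mulVec z = (θ * L.d n).mulVec y) :
    ∃ θ' : Matrix (F.ι (n + 1)) (L.ι (n + 1)) R,
      (∀ i j, θ' i j ∈ 𝒜 1) ∧ F.d n * θ' = -(θ * L.d n) ∧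
        ∀ y, ∃ z, (F.d (n + 1)).mulVec z = (θ' * L.d (n + 1)).mulVec y := by
  classical
  have hL : ∀ i j, L.d n i j ∈ 𝒜 1 := fun i j => by
    cases n <;> exact L.entry_mem _ i j
  have key : ∀ k : L.ι (n + 1), ∃ z : F.ι (n + 1) → R,
      (F.d n).mulVec z = (-(θ * L.d n)).col k ∧ ∀ j, z j ∈ 𝒜 1 := by
    intro k
    refine exists_homogeneous_solution (F.d n) (F.entry_mem n) (fun i => ?_) ?_
    · simp only [Matrix.col_apply, Matrix.neg_apply, Matrix.mul_apply]
      exact neg_mem (sum_mem fun j _ => SetLike.mul_mem_graded (hθ i j) (hL j k))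
    · obtain ⟨z, hz⟩ := hrange (-Pi.single k 1)
      refine ⟨z, hz.trans ?_⟩
      rw [Matrix.mulVec_neg, ← Matrix.neg_mulVec, Matrix.mulVec_single_one]
  choose z hz hz1 using key
  have hcomm : F.d n * Matrix.of (fun i k => z k i) = -(θ * L.d n) := by
    ext i k
    exact congrFun (hz k) i
  refine ⟨Matrix.of fun i k => z k i, fun i k => hz1 k i, hcomm, fun y => ?_⟩
  rw [← F.exact n, Matrix.mulVec_mulVec, ← Matrix.mul_assoc, hcomm, Matrix.neg_mul,
    Matrix.mul_assoc, L.d_mul_d, Matrix.mul_zero, neg_zero, Matrix.zero_mulVec]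

/-- Multiplication by `m`, as a map `R ⧸ (I : m) → R ⧸ I`, lifts (up to sign) to a map from the
resolution of `R ⧸ (I : m)` to that of `R ⧸ I` with homogeneous entries. -/
lemma exists_lift [GradedAlgebra 𝒜] {q : ℕ} {I : Ideal R} {m : R} (hm : m ∈ 𝒜 q)
    (F : LinearMatrixResolution 𝒜 q I)
    (L : LinearMatrixResolution 𝒜 1 (Submodule.colon I {m})) :
    ∃ θ : ∀ n, Matrix (F.ι n) (L.ι n) R, (∀ i j, θ 0 i j = m) ∧
      (∀ n i j, θ n i j ∈ 𝒜 (linearEntryDegree q n)) ∧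
        ∀ n, F.d n * θ (n + 1) = -(θ n * L.d n) := by
  let P : ∀ n, Matrix (F.ι n) (L.ι n) R → Prop := fun n θ =>
    (∀ i j, θ i j ∈ 𝒜 (linearEntryDegree q n)) ∧
      ∀ y, ∃ z, (F.d n).mulVec z = (θ * L.d n).mulVec y
  have step : ∀ n (θ : {θ // P n θ}), ∃ θ' : {θ' // P (n + 1) θ'},
      F.d n * θ'.1 = -(θ.1 * L.d n) := by
    rintro n ⟨θ, hθ, hr⟩
    obtain ⟨θ', h1, h2, h3⟩ := exists_lift_step F L n θ hθ hr
    exact ⟨⟨θ', h1, h3⟩, h2⟩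
  choose next hnext using step
  have h0 : P 0 (Matrix.of fun _ _ => m) := by
    refine ⟨fun _ _ => hm, fun y => (F.range_zero _).2 fun i => ?_⟩
    rw [← Matrix.mulVec_mulVec]
    refine sum_mem fun j _ => ?_
    have := (L.range_zero ((L.d 0).mulVec y)).1 ⟨y, rfl⟩ j
    rw [Submodule.mem_colon_singleton, smul_eq_mul, mul_comm] at this
    exact this
  let Θ : ∀ n, {θ // P n θ} := fun n => Nat.rec ⟨_, h0⟩ (fun n θ => next n θ) n
  exact ⟨fun n => (Θ n).1, fun _ _ => rfl, fun n => (Θ n).2.1, fun n => hnext n (Θ n)⟩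

/-! ### The mapping cone -/

/-- The bases of the free modules of a mapping cone. -/
def ConeIndex (ι κ : ℕ → Type) : ℕ → Type
  | 0 => ι 0
  | n + 1 => ι (n + 1) ⊕ κ n

/-- The differentials of the mapping cone of a map `θ` from the complex `k` to the complex `d`. -/
def coneMatrix {ι κ : ℕ → Type} (d : ∀ n, Matrix (ι n) (ι (n + 1)) R)
    (k : ∀ n, Matrix (κ n) (κ (n + 1)) R) (θ : ∀ n, Matrix (ι n) (κ n) R) :
    ∀ n, Matrix (ConeIndex ι κ n) (ConeIndex ι κ (n + 1)) R
  | 0 => Matrix.fromCols (d 0) (θ 0)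
  | n + 1 => Matrix.fromBlocks (d (n + 1)) (θ (n + 1)) 0 (k n)

/-- If `I` has a `q`-linear resolution, `m` has degree `q`, and `I : m` has a `1`-linear
resolution, then the mapping cone of multiplication by `m` is a `q`-linear resolution of
`I + (m)`. -/
theorem nonempty_sup_span_singleton [GradedAlgebra 𝒜] {q : ℕ} {I : Ideal R} {m : R}
    (hm : m ∈ 𝒜 q) (hI : Nonempty (LinearMatrixResolution 𝒜 q I))
    (hcolon : Nonempty (LinearMatrixResolution 𝒜 1 (Submodule.colon I {m}))) :
    Nonempty (LinearMatrixResolution 𝒜 q (I ⊔ Ideal.span {m})) := by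
  obtain ⟨F⟩ := hI
  obtain ⟨L⟩ := hcolon
  obtain ⟨θ, hθ0, hθ, hcomm⟩ := exists_lift hm F L
  have hθ0v : ∀ (y : L.ι 0 → R) i, (θ 0).mulVec y i = y L.unique.default * m := by
    intro y i
    let := L.unique
    rw [Matrix.mulVec, dotProduct, Fintype.sum_unique, hθ0, mul_comm]
  have hcommv : ∀ n z, (F.d n).mulVec ((θ (n + 1)).mulVec z)
      = -(θ n).mulVec ((L.d n).mulVec z) := by
    intro n z
    rw [Matrix.mulVec_mulVec, hcomm, Matrix.neg_mulVec, Matrix.mulVec_mulVec]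
  -- The common part of exactness in all degrees: once the second component of a cycle of the cone
  -- is a boundary `L.d n z`, the first one is a boundary up to `θ (n + 1) z`.
  have hlift : ∀ n x z, (F.d n).mulVec x + (θ n).mulVec ((L.d n).mulVec z) = 0 →
      ∃ w, (F.d (n + 1)).mulVec w + (θ (n + 1)).mulVec z = x := by
    intro n x z h
    obtain ⟨w, hw⟩ := (F.exact n (x - (θ (n + 1)).mulVec z)).1 (by
      rw [Matrix.mulVec_sub, hcommv, sub_neg_eq_add, h])
    exact ⟨w, by rw [hw, sub_add_cancel]⟩
  refine ⟨{
    ι := ConeIndex F.ι L.ι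
    fintype := fun n => match n with
      | 0 => F.fintype 0
      | n + 1 => inferInstanceAs (Fintype (F.ι (n + 1) ⊕ L.ι n))
    unique := F.unique
    d := coneMatrix F.d L.d θ
    entry_mem := ?_
    range_zero := ?_
    exact := ?_ }⟩
  · rintro (_ | n) i (j | j)
    · exact F.entry_mem 0 i j
    · exact hθ 0 i j
    · rcases i with i | i
      · exact F.entry_mem (n + 1) i j
      · exact zero_mem _
    · rcases i with i | i
      · exact hθ (n + 1) i j
      · have := L.entry_mem n i j
        cases n <;> exact this
  · change ∀ x : F.ι 0 → R,
      (∃ y : F.ι 1 ⊕ L.ι 0 → R, (Matrix.fromCols (F.d 0) (θ 0)).mulVec y = x) ↔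
        ∀ i : F.ι 0, x i ∈ I ⊔ Ideal.span {m}
    intro x
    simp only [Matrix.fromCols_mulVec]
    constructor
    · rintro ⟨y, rfl⟩ i
      rw [Pi.add_apply, hθ0v]
      exact Ideal.add_mem _ (Ideal.mem_sup_left ((F.range_zero _).1 ⟨_, rfl⟩ i))
        (Ideal.mem_sup_right (Ideal.mul_mem_left _ _ (Ideal.mem_span_singleton_self m)))
    · intro h
      let := F.unique
      obtain ⟨a, ha, b, hb, hab⟩ := Submodule.mem_sup.1 (h default)
      obtain ⟨c, rfl⟩ := Ideal.mem_span_singleton'.1 hb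
      obtain ⟨y, hy⟩ := (F.range_zero fun _ => a).2 fun _ => ha
      refine ⟨Sum.elim y fun _ => c, ?_⟩
      funext i
      rw [Sum.elim_comp_inl, Sum.elim_comp_inr, Pi.add_apply, hθ0v, hy, hab,
        Unique.eq_default i]
  · rintro (_ | n)
    · change ∀ x : F.ι 1 ⊕ L.ι 0 → R, (Matrix.fromCols (F.d 0) (θ 0)).mulVec x = 0 ↔
        ∃ y : F.ι 2 ⊕ L.ι 1 → R,
          (Matrix.fromBlocks (F.d 1) (θ 1) 0 (L.d 0)).mulVec y = x
      intro x
      rw [Matrix.fromCols_mulVec]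
      constructor
      · intro h
        obtain ⟨z, hz⟩ := (L.range_zero (x ∘ Sum.inr)).2 fun i => by
          let := F.unique
          let := L.unique
          have h' := congrFun h default
          rw [Pi.add_apply, hθ0v, Pi.zero_apply] at h'
          rw [Submodule.mem_colon_singleton, Unique.eq_default i, smul_eq_mul,
            eq_neg_of_add_eq_zero_right h']
          exact neg_mem ((F.range_zero _).1 ⟨_, rfl⟩ _)
        obtain ⟨w, hw⟩ := hlift 0 (x ∘ Sum.inl) z (by rw [hz, h])
        refine ⟨Sum.elim w z, ?_⟩
        rw [Matrix.fromBlocks_mulVec, Sum.elim_comp_inl, Sum.elim_comp_inr, hw, hz,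
          Matrix.zero_mulVec, zero_add (x ∘ Sum.inr), Sum.elim_comp_inl_inr]
      · rintro ⟨y, rfl⟩
        rw [Matrix.fromBlocks_mulVec, Sum.elim_comp_inl, Sum.elim_comp_inr, Matrix.mulVec_add,
          (F.exact 0 _).2 ⟨_, rfl⟩, hcommv, Matrix.zero_mulVec,
          zero_add (-(θ 0).mulVec _), zero_add ((L.d 0).mulVec _), neg_add_cancel]
    · change ∀ x : F.ι (n + 2) ⊕ L.ι (n + 1) → R,
        (Matrix.fromBlocks (F.d (n + 1)) (θ (n + 1)) 0 (L.d n)).mulVec x = 0 ↔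
        ∃ y : F.ι (n + 3) ⊕ L.ι (n + 2) → R,
          (Matrix.fromBlocks (F.d (n + 2)) (θ (n + 2)) 0 (L.d (n + 1))).mulVec y = x
      intro x
      rw [Matrix.fromBlocks_mulVec]
      constructor
      · intro h
        have h1 : (F.d (n + 1)).mulVec (x ∘ Sum.inl) + (θ (n + 1)).mulVec (x ∘ Sum.inr) = 0 :=
          funext fun i => congrFun h (Sum.inl i)
        have h2 : (L.d n).mulVec (x ∘ Sum.inr) = 0 := funext fun i => by
          simpa using congrFun h (Sum.inr i)
        obtain ⟨z, hz⟩ := (L.exact n _).1 h2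
        obtain ⟨w, hw⟩ := hlift (n + 1) (x ∘ Sum.inl) z (by rw [hz, h1])
        refine ⟨Sum.elim w z, ?_⟩
        rw [Matrix.fromBlocks_mulVec, Sum.elim_comp_inl, Sum.elim_comp_inr, hw, hz,
          Matrix.zero_mulVec, zero_add (x ∘ Sum.inr), Sum.elim_comp_inl_inr]
      · rintro ⟨y, rfl⟩
        rw [Matrix.fromBlocks_mulVec, Sum.elim_comp_inl, Sum.elim_comp_inr, Matrix.mulVec_add,
          (F.exact (n + 1) _).2 ⟨_, rfl⟩, hcommv, Matrix.zero_mulVec,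
          zero_add (-(θ (n + 1)).mulVec _), zero_add ((L.d (n + 1)).mulVec _), neg_add_cancel,
          Matrix.zero_mulVec, (L.exact n _).2 ⟨_, rfl⟩, add_zero]
        funext i
        cases i <;> rfl

/-! ### Passing to graded free resolutions -/

/-- The degree of the basis elements of the `n`-th free module in the `q`-linear resolution of
`R ⧸ I`. -/
def linearBasisDegree (q : ℕ) : ℕ → ℕ
  | 0 => 0
  | n + 1 => q + n

theorem hasLinearResolutionOfQuotient [GradedAlgebra 𝒜] {q : ℕ} (hq : 0 < q) {I : Ideal R}
    (F : LinearMatrixResolution 𝒜 q I) : HasLinearResolutionOfQuotient 𝒜 I q := by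
  classical
  let e : ∀ n, Fin (Fintype.card (F.ι n)) ≃ F.ι n := fun n => (Fintype.equivFin (F.ι n)).symm
  let := F.unique
  have hdeg : ∀ n, linearBasisDegree q n + linearEntryDegree q n
      = linearBasisDegree q (n + 1) := by
    rintro (_ | n) <;> simp [linearBasisDegree, linearEntryDegree, add_assoc]
  have hpos : ∀ n, 0 < linearEntryDegree q n := by
    rintro (_ | n)
    exacts [hq, one_pos]
  let aug : (Fin (Fintype.card (F.ι 0)) → R) →ₗ[R] R ⧸ I :=
    (Submodule.mkQ I).comp (LinearMap.proj ((e 0).symm default))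
  have hmul : ∀ n (x : Fin (Fintype.card (F.ι (n + 1))) → R),
      ((F.d n).submatrix (e n) (e (n + 1))).mulVec x
        = (F.d n).mulVec (x ∘ (e (n + 1)).symm) ∘ e n := fun n x =>
    Matrix.submatrix_mulVec_equiv _ _ _ _
  have hrange : ∀ n (x : Fin (Fintype.card (F.ι n)) → R),
      (∃ y, ((F.d n).submatrix (e n) (e (n + 1))).mulVec y = x) ↔
        ∃ y, (F.d n).mulVec y = x ∘ (e n).symm := by
    intro n x
    constructor
    · rintro ⟨y, rfl⟩
      refine ⟨y ∘ (e (n + 1)).symm, ?_⟩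
      rw [hmul]
      funext i
      simp
    · rintro ⟨y, hy⟩
      refine ⟨y ∘ e (n + 1), ?_⟩
      rw [hmul]
      funext i
      simp [Function.comp_assoc, hy]
  refine ⟨{
    rank := fun n => Fintype.card (F.ι n)
    deg := fun n _ => linearBasisDegree q n
    d := fun n => (F.d n).submatrix (e n) (e (n + 1))
    aug := aug
    aug_homogeneous := fun j => ?_
    d_homogeneous := fun n i j => Or.inr ⟨_, hdeg n, F.entry_mem n _ _⟩
    minimal := fun n i j => Ideal.subset_span ⟨_, hpos n, F.entry_mem n _ _⟩
    aug_surjective := fun x => ?_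
    exact_zero := fun x => ?_
    exact_succ := fun n x => ?_ }, Fintype.card_unique, fun _ => rfl, fun _ _ => rfl,
      fun i j => F.entry_mem 0 _ _, fun n i j => F.entry_mem (n + 1) _ _⟩
  · have hj : j = (e 0).symm default := (e 0).injective (Subsingleton.elim _ _)
    refine ⟨1, SetLike.GradedOne.one_mem, ?_⟩
    simp [aug, hj]
  · obtain ⟨r, rfl⟩ := Submodule.mkQ_surjective I x
    exact ⟨fun _ => r, rfl⟩
  · rw [Set.mem_range]
    simp only [Matrix.mulVecLin_apply]
    rw [hrange, F.range_zero, Unique.forall_iff]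
    exact Ideal.Quotient.eq_zero_iff_mem
  · rw [Set.mem_range]
    simp only [Matrix.mulVecLin_apply]
    rw [hrange, ← F.exact, hmul]
    constructor
    · intro h
      funext i
      simpa using congrFun h ((e n).symm i)
    · intro h
      rw [h]
      rfl

end LinearMatrixResolution

open MvPolynomial

/-! ### Edge ideals with linear quotients -/

section LinearQuotients

variable {K : Type*} [Field K] {V : Type*}

/-- Ideals generated by variables have `1`-linear resolutions: the iterated mapping cones are the
Koszul complexes, as every variable is a nonzerodivisor modulo the others. -/
theorem nonempty_linearMatrixResolution_span_X [DecidableEq V] (s : Finset V) :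
    Nonempty (LinearMatrixResolution (homogeneousSubmodule V K) 1
      (Ideal.span (X '' (s : Set V)))) := by
  have : GradedAlgebra (homogeneousSubmodule V K) := gradedAlgebra
  induction s using Finset.induction_on with
  | empty => simpa using LinearMatrixResolution.nonempty_bot (homogeneousSubmodule V K) 1
  | insert a s ha ih =>
    have hcolon : Submodule.colon (Ideal.span (X '' (s : Set V)) : Ideal (MvPolynomial V K)) {X a}
        = Ideal.span (X '' (s : Set V)) := by
      ext f
      rw [Submodule.mem_colon_singleton, smul_eq_mul]
      refine ⟨fun h => ?_, fun h => Ideal.mul_mem_right _ _ h⟩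
      rw [mem_ideal_span_X_image] at h ⊢
      intro m hm
      obtain ⟨i, hi, hmi⟩ := h (m + Finsupp.single a 1) (by
        rw [mem_support_iff, coeff_mul_X]
        exact mem_support_iff.1 hm)
      have hia : a ≠ i := fun h => ha (h ▸ hi)
      exact ⟨i, hi, by simpa [Finsupp.single_apply, hia] using hmi⟩
    have := LinearMatrixResolution.nonempty_sup_span_singleton (isHomogeneous_X K a) ih
      (by rwa [hcolon])
    rwa [← Ideal.span_union, Set.union_singleton, ← Set.image_insert_eq, ← Finset.coe_insert]
      at this

/-- A polynomial lies in an ideal generated by squarefree quadratic monomials if and only if each of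
its monomials is divisible by one of the generators. -/
lemma mem_span_X_mul_X_iff {r : V → V → Prop} (hr : ∀ v w, r v w → v ≠ w)
    {f : MvPolynomial V K} :
    f ∈ Ideal.span {f : MvPolynomial V K | ∃ v w, r v w ∧ f = X v * X w} ↔
      ∀ m ∈ f.support, ∃ v w, r v w ∧ m v ≠ 0 ∧ m w ≠ 0 := by
  have : Ideal.span {f : MvPolynomial V K | ∃ v w, r v w ∧ f = X v * X w}
      = Ideal.span ((fun s => monomial s (1 : K)) ''
        {s | ∃ v w, r v w ∧ s = Finsupp.single v 1 + Finsupp.single w 1}) := by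
    congr 1
    ext f
    constructor
    · rintro ⟨v, w, h, rfl⟩
      exact ⟨_, ⟨v, w, h, rfl⟩, by simp [X, monomial_mul]⟩
    · rintro ⟨_, ⟨v, w, h, rfl⟩, rfl⟩
      exact ⟨v, w, h, by simp [X, monomial_mul]⟩
  rw [this, mem_ideal_span_monomial_image]
  refine forall₂_congr fun m _ => ⟨?_, ?_⟩
  · rintro ⟨_, ⟨v, w, h, rfl⟩, hle⟩
    refine ⟨v, w, h, ?_, ?_⟩
    · have := hle v
      simp at this
      omega
    · have := hle w
      simp at this
      omega
  · rintro ⟨v, w, h, hv, hw⟩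
    refine ⟨_, ⟨v, w, h, rfl⟩, fun u => ?_⟩
    have hvw : v ≠ w := hr v w h
    classical
    rw [Finsupp.add_apply, Finsupp.single_apply, Finsupp.single_apply]
    split_ifs with hu hu' hu'
    · exact absurd (hu.trans hu'.symm) hvw
    · subst hu; omega
    · subst hu'; omega
    · omega

lemma mem_edgeIdeal_iff {G : SimpleGraph V} {f : MvPolynomial V K} :
    f ∈ edgeIdeal K G ↔ ∀ m ∈ f.support, ∃ v w, G.Adj v w ∧ m v ≠ 0 ∧ m w ≠ 0 :=
  mem_span_X_mul_X_iff fun _ _ h => h.ne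

/-- The ideal generated by the edges `{i, j}` of `G` with `ρ i < ρ j` that come before `c` in the
lexicographic order of the pairs `(ρ i, ρ j)`, for an injection `ρ : V → ℕ`. -/
noncomputable def initialEdgeIdeal (K : Type*) [Field K] (G : SimpleGraph V) (ρ : V → ℕ)
    (c : ℕ ×ₗ ℕ) : Ideal (MvPolynomial V K) :=
  Ideal.span {f | ∃ v w, (G.Adj v w ∧ ρ v < ρ w ∧ toLex (ρ v, ρ w) < c) ∧ f = X v * X w}

lemma mem_initialEdgeIdeal_iff {G : SimpleGraph V} {ρ : V → ℕ} {c : ℕ ×ₗ ℕ}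
    {f : MvPolynomial V K} :
    f ∈ initialEdgeIdeal K G ρ c ↔ ∀ m ∈ f.support, ∃ v w,
      (G.Adj v w ∧ ρ v < ρ w ∧ toLex (ρ v, ρ w) < c) ∧ m v ≠ 0 ∧ m w ≠ 0 :=
  mem_span_X_mul_X_iff fun _ _ h => h.1.ne

/-- If later vertices have smaller neighbourhoods than the earlier vertices not adjacent to them,
then the colon ideal of the lexicographic initial edge ideal by the edge `{i, j}` is generated by the
variables that come before `X i` and the earlier neighbours of `i` among those before `X j`. -/
lemma colon_initialEdgeIdeal {G : SimpleGraph V} {ρ : V → ℕ} (hρ : Function.Injective ρ)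
    (hG : ∀ u v w, ρ u < ρ v → ¬ G.Adj u v → G.Adj v w → G.Adj u w) {i j : V}
    (hij : ρ i < ρ j) (hadj : G.Adj i j) :
    Submodule.colon (initialEdgeIdeal K G ρ (toLex (ρ i, ρ j))) {X i * X j}
      = Ideal.span (X '' {k | ρ k < ρ i ∨ (ρ k < ρ j ∧ G.Adj i k)}) := by
  apply le_antisymm
  · intro f hf
    rw [Submodule.mem_colon_singleton, smul_eq_mul, mem_initialEdgeIdeal_iff] at hf
    rw [mem_ideal_span_X_image]
    intro m hm
    obtain ⟨v, w, ⟨hvw, -, hc⟩, hv, hw⟩ :=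
      hf (m + Finsupp.single i 1 + Finsupp.single j 1) (by
        rw [mem_support_iff, ← mul_assoc, coeff_mul_X, coeff_mul_X]
        exact mem_support_iff.1 hm)
    rw [Prod.Lex.toLex_lt_toLex] at hc
    rcases hc with hc | ⟨hc, hc'⟩
    · have h1 : i ≠ v := fun h => by subst h; exact hc.false
      have h2 : j ≠ v := fun h => by subst h; exact hij.asymm hc
      exact ⟨v, Or.inl hc, by simpa [Finsupp.single_apply, h1, h2] using hv⟩
    · obtain rfl := hρ hc
      have h2 : j ≠ w := fun h => by subst h; exact hc'.false
      exact ⟨w, Or.inr ⟨hc', hvw⟩, by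
        simpa [Finsupp.single_apply, hvw.ne, h2] using hw⟩
  · rw [Ideal.span_le]
    rintro _ ⟨k, hk, rfl⟩
    rw [SetLike.mem_coe, Submodule.mem_colon_singleton, smul_eq_mul]
    -- One of the edges `{k, i}` and `{k, j}` exists and precedes `{i, j}`.
    have hki : ρ k < ρ i → G.Adj k i → X k * (X i * X j) ∈
        initialEdgeIdeal K G ρ (toLex (ρ i, ρ j)) := fun hlt had => by
      rw [← mul_assoc]
      exact Ideal.mul_mem_right _ _ (Ideal.subset_span
        ⟨k, i, ⟨had, hlt, Prod.Lex.toLex_lt_toLex.2 (Or.inl hlt)⟩, rfl⟩)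
    rcases hk with hk | ⟨hk, had⟩
    · by_cases had : G.Adj k i
      · exact hki hk had
      · rw [mul_left_comm]
        exact Ideal.mul_mem_left _ _ (Ideal.subset_span
          ⟨k, j, ⟨hG k i j hk had hadj, hk.trans hij, Prod.Lex.toLex_lt_toLex.2 (Or.inl hk)⟩,
            rfl⟩)
    · rcases lt_trichotomy (ρ k) (ρ i) with hlt | heq | hgt
      · exact hki hlt had.symm
      · exact absurd (hρ heq).symm had.ne
      · rw [← mul_assoc, mul_comm (X k)]
        exact Ideal.mul_mem_right _ _ (Ideal.subset_span
          ⟨i, k, ⟨had, hgt, Prod.Lex.toLex_lt_toLex.2 (Or.inr ⟨rfl, hk⟩)⟩, rfl⟩)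

/-- Adding the edges one by one in lexicographic order, each step is a mapping cone over an ideal
of variables. -/
theorem nonempty_linearMatrixResolution_edgeIdeal [Finite V] {G : SimpleGraph V} {ρ : V → ℕ}
    (hρ : Function.Injective ρ)
    (hG : ∀ u v w, ρ u < ρ v → ¬ G.Adj u v → G.Adj v w → G.Adj u w) :
    Nonempty (LinearMatrixResolution (homogeneousSubmodule V K) 2 (edgeIdeal K G)) := by
  classical
  have : GradedAlgebra (homogeneousSubmodule V K) := gradedAlgebra
  have := Fintype.ofFinite V
  let code : V × V → ℕ ×ₗ ℕ := fun e => toLex (ρ e.1, ρ e.2)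
  have hcode : Function.Injective code := fun e f h => by
    have h' := congrArg ofLex h
    simp only [code, ofLex_toLex, Prod.mk.injEq] at h'
    exact Prod.ext (hρ h'.1) (hρ h'.2)
  let E : Finset (V × V) := {e | G.Adj e.1 e.2 ∧ ρ e.1 < ρ e.2}
  let mon : V × V → MvPolynomial V K := fun e => X e.1 * X e.2
  suffices H : ∀ s : Finset (V × V), s ⊆ E → (∀ e ∈ s, ∀ f ∈ E, code f < code e → f ∈ s) →
      Nonempty (LinearMatrixResolution (homogeneousSubmodule V K) 2
        (Ideal.span (mon '' (s : Set (V × V))))) by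
    have hE : edgeIdeal K G = Ideal.span (mon '' (E : Set (V × V))) := by
      unfold edgeIdeal
      congr 1
      ext f
      constructor
      · rintro ⟨v, w, had, rfl⟩
        rcases lt_or_gt_of_ne (hρ.ne had.ne) with hlt | hgt
        · exact ⟨(v, w), by simp [E, had, hlt], rfl⟩
        · exact ⟨(w, v), by simp [E, had.symm, hgt], mul_comm _ _⟩
      · rintro ⟨⟨v, w⟩, he, rfl⟩
        exact ⟨v, w, by simp [E] at he; exact he.1, rfl⟩
    rw [hE]
    exact H E subset_rfl fun _ _ f hf _ => hf
  intro s
  induction s using Finset.induction_on_max_value code with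
  | empty => intro _ _; simpa using LinearMatrixResolution.nonempty_bot (homogeneousSubmodule V K) 2
  | insert a s ha hmax ih =>
    intro hsE hdown
    have haE : G.Adj a.1 a.2 ∧ ρ a.1 < ρ a.2 := by
      have := hsE (Finset.mem_insert_self a s)
      simpa [E] using this
    have hlt : ∀ e ∈ s, code e < code a := fun e he =>
      lt_of_le_of_ne (hmax e he) (hcode.ne fun h => ha (h ▸ he))
    have hs : ∀ e, e ∈ s ↔ e ∈ E ∧ code e < code a := fun e =>
      ⟨fun he => ⟨hsE (Finset.mem_insert_of_mem he), hlt e he⟩, fun he =>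
        Finset.mem_of_mem_insert_of_ne (hdown a (Finset.mem_insert_self a s) e he.1 he.2)
          fun h => by rw [h] at he; exact he.2.false⟩
    have hspan : Ideal.span (mon '' (s : Set (V × V))) = initialEdgeIdeal K G ρ (code a) := by
      unfold initialEdgeIdeal
      congr 1
      ext f
      constructor
      · rintro ⟨e, he, rfl⟩
        have := (hs e).1 he
        simp only [E, Finset.mem_filter, Finset.mem_univ, true_and] at this
        exact ⟨e.1, e.2, ⟨this.1.1, this.1.2, this.2⟩, rfl⟩
      · rintro ⟨v, w, ⟨h1, h2, h3⟩, rfl⟩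
        exact ⟨(v, w), (hs _).2 ⟨by simp [E, h1, h2], h3⟩, rfl⟩
    have hprev := ih (fun e he => ((hs e).1 he).1) fun e he f hf hfe =>
      (hs f).2 ⟨hf, hfe.trans (hlt e he)⟩
    have hmon : mon a ∈ homogeneousSubmodule V K 2 :=
      (isHomogeneous_X K a.1).mul (isHomogeneous_X K a.2)
    have := LinearMatrixResolution.nonempty_sup_span_singleton hmon hprev (by
      rw [hspan, colon_initialEdgeIdeal hρ hG haE.2 haE.1]
      simpa using nonempty_linearMatrixResolution_span_X (K := K)
        {k | ρ k < ρ a.1 ∨ (ρ k < ρ a.2 ∧ G.Adj a.1 k)}.toFinset)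
    rwa [← Ideal.span_union, Set.union_singleton, ← Set.image_insert_eq, ← Finset.coe_insert]
      at this

end LinearQuotients

/-! ### Nested neighbourhoods -/

/-- If no two disjoint edges are joined by at most one edge, nonadjacent vertices have nested
neighbourhoods, and these can be ordered by decreasing degree. -/
theorem SimpleGraph.exists_injective_nested_neighbors {V : Type*} [Finite V] {G : SimpleGraph V}
    (hG : ∀ p q r s, G.Adj p q → G.Adj r s → G.Adj q r ∨ G.Adj p s ∨ G.Adj q s) :
    ∃ ρ : V → ℕ, Function.Injective ρ ∧
      ∀ u v w, ρ u < ρ v → ¬ G.Adj u v → G.Adj v w → G.Adj u w := by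
  classical
  have := Fintype.ofFinite V
  let N := Fintype.card V
  let idx : V → ℕ := fun v => Fintype.equivFin V v
  have hidx : ∀ v, idx v < N := fun v => (Fintype.equivFin V v).2
  -- Vertices are ordered by decreasing degree, ties being broken by an enumeration of `V`.
  refine ⟨fun v => (N - G.degree v) * N + idx v, fun u v h => ?_, fun u v w huv hnadj hvw => ?_⟩
  · have h' : idx u = idx v := by
      have := congrArg (· % N) h
      simpa [Nat.mul_add_mod', Nat.mod_eq_of_lt (hidx _)] using this
    exact (Fintype.equivFin V).injective (Fin.ext h')
  · by_contra huw
    -- `w` is a neighbour of `v` only, so the neighbours of `u` are among those of `v`.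
    have hsub : G.neighborFinset u ⊂ G.neighborFinset v := by
      rw [Finset.ssubset_iff_of_subset]
      · exact ⟨w, by simpa using hvw, by simpa using huw⟩
      · intro x hx
        rw [SimpleGraph.mem_neighborFinset] at hx ⊢
        rcases hG x u w v hx.symm hvw.symm with h | h | h
        · exact absurd h huw
        · exact h.symm
        · exact absurd h hnadj
    have hdeg : G.degree u < G.degree v := Finset.card_lt_card hsub
    have hlt : G.degree v < N := G.degree_lt_card_verts v
    have : N - G.degree v + 1 ≤ N - G.degree u := by omega
    have := Nat.mul_le_mul_right N this
    have := hidx v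
    simp only at huv
    nlinarith

/-! ### Linearity of annihilators of linear forms -/

/-- What a linear resolution of `R ⧸ (x)` says about its first two matrices. The free module in
degree `0` is not assumed to be `R` here, so the augmentation enters through representatives `a i`
of the images of the basis elements, and through the coordinates `e i` of a preimage of `1`. -/
lemma HasLinearResolution.exists_presentation {K R : Type*} [Field K] [CommRing R] [Algebra K R]
    {𝒜 : ℕ → Submodule K R} {x : R}
    (h : HasLinearResolution 𝒜 (quotientGrading 𝒜 (Ideal.span {x}))) :
    ∃ (l m n : ℕ) (d : Matrix (Fin l) (Fin m) R) (d' : Matrix (Fin m) (Fin n) R)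
      (a e : Fin l → R), (∀ i j, d i j ∈ 𝒜 1) ∧ (∀ i j, d' i j ∈ 𝒜 1) ∧
      (∀ v, d.mulVec v = 0 ↔ ∃ z, d'.mulVec z = v) ∧
      (∀ k, ∃ r, ∑ i, d i k * a i = x * r) ∧ (∃ r, ∑ i, e i * a i - 1 = x * r) ∧
      ∃ w, d.mulVec w = x • e := by
  classical
  obtain ⟨F, hF⟩ := h
  let π := Ideal.Quotient.mk (Ideal.span {x})
  have hπ : ∀ r, π r = 0 ↔ ∃ t, r = x * t := fun r =>
    Ideal.Quotient.eq_zero_iff_mem.trans Ideal.mem_span_singleton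
  choose a ha using fun i => Ideal.Quotient.mk_surjective (F.aug (Pi.single i 1))
  have haug : ∀ v, F.aug v = π (∑ i, v i * a i) := by
    intro v
    conv_lhs => rw [pi_eq_sum_univ' v]
    rw [map_sum, map_sum]
    refine Finset.sum_congr rfl fun i _ => ?_
    rw [map_smul, map_mul, ha, Algebra.smul_def]
    rfl
  obtain ⟨e, he⟩ := F.aug_surjective 1
  refine ⟨_, _, _, F.d 0, F.d 1, a, e, hF 0, hF 1, F.exact_succ 0, fun k => ?_, ?_, ?_⟩
  · rw [← hπ]
    have := (F.exact_zero _).2 ⟨Pi.single k 1, rfl⟩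
    rw [haug, Matrix.mulVecLin_apply, Matrix.mulVec_single_one] at this
    exact this
  · rw [← hπ, map_sub, ← haug, he, map_one, sub_self]
  · refine (F.exact_zero (x • e)).1 ?_
    rw [map_smul, he, Algebra.smul_def, mul_one]
    exact (hπ x).2 ⟨1, (mul_one x).symm⟩

section Annihilators

variable {K : Type*} [Field K] {V : Type*}

lemma homogeneousComponent_one_mul {p : MvPolynomial V K} (hp : p ∈ homogeneousSubmodule V K 1)
    (f : MvPolynomial V K) :
    homogeneousComponent 1 (p * f) = p * C (constantCoeff f) := by
  let : GradedAlgebra (homogeneousSubmodule V K) := gradedAlgebra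
  have := DirectSum.coe_decompose_mul_add_of_left_mem (homogeneousSubmodule V K) (j := 0)
    (b := f) hp
  rw [constantCoeff_eq, ← homogeneousComponent_zero]
  exact (decomposition.decompose'_apply (p * f) 1).symm.trans
    (this.trans (congrArg _ (decomposition.decompose'_apply f 0)))

/-- Let `I` be an ideal of polynomials without terms of degree at most `1`, and let the linear form
`L` generate an ideal of `S ⧸ I` with linear resolution. Then the annihilator of `L` in `S ⧸ I` is,
up to localization at the origin, generated by linear forms. -/
theorem exists_mul_mem_span_linear_annihilators {I : Ideal (MvPolynomial V K)}
    (hI0 : ∀ f ∈ I, constantCoeff f = 0) (hI1 : ∀ f ∈ I, homogeneousComponent 1 f = 0)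
    {L : MvPolynomial V K} (hL : L ∈ homogeneousSubmodule V K 1) (hL0 : L ≠ 0)
    (hres : HasLinearResolution (quotientGrading (homogeneousSubmodule V K) I)
      (quotientGrading (quotientGrading (homogeneousSubmodule V K) I)
        (Ideal.span {Ideal.Quotient.mk I L})))
    {f : MvPolynomial V K} (hf : f * L ∈ I) :
    ∃ u : MvPolynomial V K, constantCoeff u = 1 ∧
      f * u ∈ I ⊔ Ideal.span {H | H ∈ homogeneousSubmodule V K 1 ∧ H * L ∈ I} := by
  classical
  obtain ⟨l, m, n, d, d', a, e, hd, hd', hexact, ha, he, w, hw⟩ := hres.exists_presentation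
  have hsurj : Function.Surjective (Ideal.Quotient.mk I) := Ideal.Quotient.mk_surjective
  have hL' : constantCoeff L = 0 := IsHomogeneous.coeff_eq_zero hL (d := 0) (by simp)
  -- Lift everything to the polynomial ring.
  choose D hD hDmk using hd
  choose D' hD' hDmk' using hd'
  choose A hA using fun i => hsurj (a i)
  choose E hE using fun i => hsurj (e i)
  choose W hW using fun k => hsurj (w k)
  obtain rfl : (fun i => Ideal.Quotient.mk I (A i)) = a := funext hA
  obtain rfl : (fun i => Ideal.Quotient.mk I (E i)) = e := funext hE
  obtain rfl : (fun k => Ideal.Quotient.mk I (W k)) = w := funext hW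
  obtain rfl : (Matrix.of D).map (Ideal.Quotient.mk I) = d := Matrix.ext hDmk
  obtain rfl : (Matrix.of D').map (Ideal.Quotient.mk I) = d' := Matrix.ext hDmk'
  have hmulVec : ∀ {α β : Type} [Fintype β] (M : α → β → MvPolynomial V K)
      (v : β → MvPolynomial V K),
      ((Matrix.of M).map (Ideal.Quotient.mk I)).mulVec (fun k => Ideal.Quotient.mk I (v k))
        = fun i => Ideal.Quotient.mk I (∑ k, M i k * v k) := by
    intro α β _ M v
    funext i
    simp [Matrix.mulVec, dotProduct]
  -- The constant terms of `A` combine the rows of the first matrix to scalar multiples of `L`.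
  have hb : ∀ k, ∃ b : K, ∑ i, D i k * C (constantCoeff (A i)) = L * C b := by
    intro k
    obtain ⟨r, hr⟩ := ha k
    obtain ⟨B, rfl⟩ := hsurj r
    have hB : ∑ i, D i k * A i - L * B ∈ I := by
      rw [← Ideal.Quotient.mk_eq_mk_iff_sub_mem]
      simpa using hr
    have h1 := hI1 _ hB
    rw [map_sub, map_sum, sub_eq_zero, homogeneousComponent_one_mul hL] at h1
    refine ⟨constantCoeff B, h1 ▸ Finset.sum_congr rfl fun i _ => ?_⟩
    rw [← homogeneousComponent_one_mul (hD i k)]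
  choose b hb using hb
  have hE1 : ∑ i, constantCoeff (E i) * constantCoeff (A i) = 1 := by
    obtain ⟨r, hr⟩ := he
    obtain ⟨B, rfl⟩ := hsurj r
    have hB : ∑ i, E i * A i - 1 - L * B ∈ I := by
      rw [← Ideal.Quotient.mk_eq_mk_iff_sub_mem]
      simpa using hr
    simpa [hL', sub_eq_zero] using hI0 _ hB
  rw [hmulVec] at hw
  have hw' : ∀ i, ∑ k, D i k * W k - L * E i ∈ I := fun i => by
    rw [← Ideal.Quotient.mk_eq_mk_iff_sub_mem, map_mul]
    exact congrFun hw i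
  obtain ⟨z, hz⟩ := (hexact fun k => Ideal.Quotient.mk I (f * W k)).1 (by
    rw [hmulVec]
    funext i
    refine Ideal.Quotient.eq_zero_iff_mem.2 ?_
    have : ∑ k, D i k * (f * W k) = f * (∑ k, D i k * W k - L * E i) + E i * (f * L) := by
      have h1 : ∑ k, D i k * (f * W k) = f * ∑ k, D i k * W k := by
        rw [Finset.mul_sum]
        exact Finset.sum_congr rfl fun k _ => mul_left_comm _ _ _
      rw [h1]
      ring
    rw [this]
    exact I.add_mem (I.mul_mem_left _ (hw' i)) (I.mul_mem_left _ hf))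
  choose Z hZ using fun j => hsurj (z j)
  obtain rfl : (fun j => Ideal.Quotient.mk I (Z j)) = z := funext hZ
  rw [hmulVec] at hz
  have hz' : ∀ k, f * W k - ∑ j, D' k j * Z j ∈ I := fun k => by
    rw [← Ideal.Quotient.mk_eq_mk_iff_sub_mem]
    exact (congrFun hz k).symm
  have hDD : ∀ i j, ∑ k, D i k * D' k j ∈ I := by
    intro i j
    have h := (hexact _).2 ⟨Pi.single j 1, rfl⟩
    rw [Matrix.mulVec_single_one] at h
    have h' := (hmulVec D fun k => D' k j).symm.trans h
    exact Ideal.Quotient.eq_zero_iff_mem.1 (congrFun h' i)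
  -- The linear forms `H j` annihilate `L`, and `f * u` is a combination of them modulo `I`.
  let u := ∑ k, C (b k) * W k
  let H := fun j => ∑ k, C (b k) * D' k j
  have hLC : ∀ g : Fin m → MvPolynomial V K, L * ∑ k, C (b k) * g k
      = ∑ i, C (constantCoeff (A i)) * ∑ k, D i k * g k := by
    intro g
    simp only [Finset.mul_sum]
    rw [Finset.sum_comm]
    refine Finset.sum_congr rfl fun k _ => ?_
    rw [← mul_assoc, ← hb, Finset.sum_mul]
    refine Finset.sum_congr rfl fun i _ => ?_
    ring
  refine ⟨u, ?_, ?_⟩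
  · have h : L * (u - ∑ i, C (constantCoeff (A i)) * E i) ∈ I := by
      have : L * (u - ∑ i, C (constantCoeff (A i)) * E i)
          = ∑ i, C (constantCoeff (A i)) * (∑ k, D i k * W k - L * E i) := by
        rw [mul_sub, hLC, Finset.mul_sum, ← Finset.sum_sub_distrib]
        refine Finset.sum_congr rfl fun i _ => ?_
        ring
      rw [this]
      exact sum_mem fun i _ => I.mul_mem_left _ (hw' i)
    have h1 := hI1 _ h
    rw [homogeneousComponent_one_mul hL] at h1
    have h2 := C_eq_zero.1 ((mul_eq_zero.1 h1).resolve_left hL0)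
    rw [map_sub, sub_eq_zero] at h2
    rw [h2, ← hE1, map_sum]
    refine Finset.sum_congr rfl fun i _ => ?_
    rw [map_mul, constantCoeff_C, mul_comm]
  · have hsplit : f * u = ∑ k, C (b k) * (f * W k - ∑ j, D' k j * Z j) + ∑ j, Z j * H j := by
      have : ∑ j, Z j * H j = ∑ k, C (b k) * ∑ j, D' k j * Z j := by
        simp only [H, Finset.mul_sum]
        rw [Finset.sum_comm]
        refine Finset.sum_congr rfl fun k _ => Finset.sum_congr rfl fun j _ => ?_
        ring
      rw [this, ← Finset.sum_add_distrib, Finset.mul_sum]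
      refine Finset.sum_congr rfl fun k _ => ?_
      ring
    rw [hsplit]
    refine Ideal.add_mem _ (Ideal.mem_sup_left (sum_mem fun k _ => I.mul_mem_left _ (hz' k)))
      (Ideal.mem_sup_right (sum_mem fun j _ => Ideal.mul_mem_left _ _ (Ideal.subset_span ⟨?_, ?_⟩)))
    · exact sum_mem fun k _ => by
        rw [← smul_eq_C_mul]
        exact Submodule.smul_mem _ _ (hD' k j)
    · rw [mul_comm, hLC]
      exact sum_mem fun i _ => I.mul_mem_left _ (hDD i j)

/-! ### Edge rings in which linear forms have linear annihilators -/

/-- If `q` is adjacent to `p` but not to `r`, then the linear forms annihilating `X p + X r` modulo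
the edge ideal do not involve `X q`. -/
lemma coeff_single_eq_zero_of_mul_mem_edgeIdeal {G : SimpleGraph V} {p q r : V} (hpr : p ≠ r)
    (hpq : G.Adj p q) (hqr : ¬ G.Adj q r) {H : MvPolynomial V K}
    (hH : H * (X p + X r) ∈ edgeIdeal K G) : coeff (Finsupp.single q 1) H = 0 := by
  classical
  by_contra h
  obtain ⟨v, w, hvw, hv, hw⟩ := mem_edgeIdeal_iff.1 hH (Finsupp.single q 1 + Finsupp.single r 1)
    (by
      rw [mem_support_iff, mul_add, coeff_add, coeff_mul_X, coeff_mul_X', if_neg, zero_add]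
      · exact h
      · simp [hpq.ne.symm, hpr.symm])
  have key : ∀ x, (Finsupp.single q 1 + Finsupp.single r 1 : V →₀ ℕ) x ≠ 0 → x = q ∨ x = r := by
    intro x hx
    by_contra! hx'
    simp [hx'.1.symm, hx'.2.symm] at hx
  rcases key v hv with rfl | rfl <;> rcases key w hw with rfl | rfl
  · exact hvw.ne rfl
  · exact hqr hvw
  · exact hqr hvw.symm
  · exact hvw.ne rfl

/-- Two edges `{p, q}` and `{r, s}` joined at most by `{p, r}` are excluded by the annihilator of
`X p + X r`: it contains `X q * X s`, while the linear forms in it involve neither `X q` nor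
`X s`. -/
theorem adj_of_isUniversallyKoszul {G : SimpleGraph V}
    (hG : IsUniversallyKoszul (quotientGrading (homogeneousSubmodule V K) (edgeIdeal K G)))
    {p q r s : V} (hpq : G.Adj p q) (hrs : G.Adj r s) :
    G.Adj q r ∨ G.Adj p s ∨ G.Adj q s := by
  classical
  by_contra! hcon
  obtain ⟨hqr, hps, hqs⟩ := hcon
  have hpr : p ≠ r := fun h => hqr (h ▸ hpq.symm)
  have hdeg : ∀ f ∈ edgeIdeal K G, ∀ m ∈ f.support, 2 ≤ m.degree := by
    intro f hf m hm
    obtain ⟨v, w, hvw, hv, hw⟩ := mem_edgeIdeal_iff.1 hf m hm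
    have hsub : ({v, w} : Finset V) ⊆ m.support := by
      intro x hx
      rcases Finset.mem_insert.1 hx with rfl | hx
      · exact Finsupp.mem_support_iff.2 hv
      · exact Finsupp.mem_support_iff.2 (Finset.mem_singleton.1 hx ▸ hw)
    calc 2 = ∑ x ∈ {v, w}, 1 := by simp [Finset.card_pair hvw.ne]
      _ ≤ ∑ x ∈ {v, w}, m x := Finset.sum_le_sum fun x hx =>
          Nat.one_le_iff_ne_zero.2 (Finsupp.mem_support_iff.1 (hsub hx))
      _ ≤ ∑ x ∈ m.support, m x := Finset.sum_le_sum_of_subset hsub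
  have hlin : (X p + X r : MvPolynomial V K) ∈ homogeneousSubmodule V K 1 :=
    add_mem (isHomogeneous_X K p) (isHomogeneous_X K r)
  have hne : (X p + X r : MvPolynomial V K) ≠ 0 := by
    intro h
    have := congrArg (coeff (Finsupp.single p 1)) h
    simp [coeff_X, Finsupp.single_left_inj, hpr.symm] at this
  obtain ⟨u, hu1, hu⟩ := exists_mul_mem_span_linear_annihilators (I := edgeIdeal K G)
    (L := X p + X r) (f := X q * X s)
    (fun f hf => by
      by_contra h
      simpa using hdeg f hf 0 (mem_support_iff.2 h))
    (fun f hf => by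
      ext m
      rw [coeff_homogeneousComponent, coeff_zero]
      split_ifs with hm
      · by_contra h
        have := hdeg f hf m (mem_support_iff.2 h)
        omega
      · rfl)
    hlin hne
    (hG _ (Set.singleton_subset_iff.2 ⟨_, hlin, rfl⟩))
    (by
      rw [mul_add]
      refine Ideal.add_mem _ ?_ ?_
      · rw [mul_right_comm]
        exact Ideal.mul_mem_right _ _ (Ideal.subset_span ⟨q, p, hpq.symm, rfl⟩)
      · rw [mul_assoc]
        exact Ideal.mul_mem_left _ _ (Ideal.subset_span ⟨s, r, hrs.symm, rfl⟩))
  -- Edges and linear annihilators lie in the ideal of the variables other than `X q` and `X s`.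
  have hle : edgeIdeal K G ⊔ Ideal.span {H | H ∈ homogeneousSubmodule V K 1 ∧
      H * (X p + X r) ∈ edgeIdeal K G} ≤ Ideal.span (X '' {v | v ≠ q ∧ v ≠ s}) := by
    refine sup_le (Ideal.span_le.2 ?_) (Ideal.span_le.2 ?_)
    · rintro _ ⟨v, w, hvw, rfl⟩
      by_cases hv : v ≠ q ∧ v ≠ s
      · exact Ideal.mul_mem_right _ _ (Ideal.subset_span ⟨v, hv, rfl⟩)
      · refine Ideal.mul_mem_left _ _ (Ideal.subset_span ⟨w, ?_, rfl⟩)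
        rw [not_and_or, not_not, not_not] at hv
        constructor
        · rintro rfl
          rcases hv with rfl | rfl
          exacts [hvw.ne rfl, hqs hvw.symm]
        · rintro rfl
          rcases hv with rfl | rfl
          exacts [hqs hvw, hvw.ne rfl]
    · rintro H ⟨hH1, hH⟩
      rw [SetLike.mem_coe, mem_ideal_span_X_image]
      intro m hm
      have hm1 : m.degree = 1 := by
        by_contra h
        exact mem_support_iff.1 hm (hH1.coeff_eq_zero h)
      obtain ⟨v, rfl⟩ : ∃ v, m = Finsupp.single v 1 := by
        have : m ∈ {m : V →₀ ℕ | m.degree = 1} := hm1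
        rw [← Finsupp.range_single_one] at this
        exact this.imp fun _ h => h.symm
      refine ⟨v, ⟨?_, ?_⟩, by simp⟩
      · rintro rfl
        exact mem_support_iff.1 hm (coeff_single_eq_zero_of_mul_mem_edgeIdeal hpr hpq hqr hH)
      · rintro rfl
        rw [add_comm] at hH
        exact mem_support_iff.1 hm (coeff_single_eq_zero_of_mul_mem_edgeIdeal hpr.symm hrs
          (fun h => hps h.symm) hH)
  obtain ⟨v, ⟨hvq, hvs⟩, hv⟩ := mem_ideal_span_X_image.1 (hle hu)
    (Finsupp.single q 1 + Finsupp.single s 1) (by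
      have : coeff (0 + Finsupp.single q 1 + Finsupp.single s 1) (u * X q * X s) = 1 := by
        rw [coeff_mul_X, coeff_mul_X]
        exact hu1
      rw [zero_add, mul_assoc, mul_comm] at this
      rw [mem_support_iff, this]
      exact one_ne_zero)
  simp [hvq.symm, hvs.symm] at hv

end Annihilators

theorem mainTheorem2 {K : Type*} [Field K] {V : Type*} [Finite V] (G : SimpleGraph V)
    (hG : IsUniversallyKoszul
      (quotientGrading (MvPolynomial.homogeneousSubmodule V K) (edgeIdeal K G))) :
    HasLinearResolutionOfQuotient (MvPolynomial.homogeneousSubmodule V K) (edgeIdeal K G) 2 := by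
  have : GradedAlgebra (homogeneousSubmodule V K) := gradedAlgebra
  obtain ⟨ρ, hρ, hnested⟩ := SimpleGraph.exists_injective_nested_neighbors
    fun p q r s hpq hrs => adj_of_isUniversallyKoszul hG (p := p) (q := q) (r := r) (s := s) hpq hrs
  obtain ⟨F⟩ := nonempty_linearMatrixResolution_edgeIdeal (K := K) hρ hnested
  exact F.hasLinearResolutionOfQuotient two_pos
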